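/- Let $G$ be a finite group, let $\operatorname{Irr} G$ be the set of its irreducible complex characters and $\operatorname{Cl}(G)$ the set of its conjugacy classes. For $X\subseteq\operatorname{Irr} G$ put $\sigma_X=\sum_{\chi\in X}\chi(1)\chi$. A supercharacter theory of $G$ is a pair $(\mathcal X,\mathcal K)$ of a partition $\mathcal X$ of $\operatorname{Irr} G$ and a partition $\mathcal K$ of $G$ such that $|\mathcal X|=|\mathcal K|$ and, for every $X\in\mathcal X$, the character $\sigma_X$ is constant on each member of $\mathcal K$. A table automorphism of $G$ is a pair $(\sigma,\tau)$ of a permutation $\sigma$ of $\operatorname{Irr} G$ and a permutation $\tau$ of $\operatorname{Cl}(G)$ such that $\sigma(\chi)(h)=\chi(g)$ for all $\chi\in\operatorname{Irr} G$, all $g\in G$, and all $h\in\tau(C_g)$, where $C_g$ denotes the conjugacy class of $g$; the table automorphisms form a group under composition, which acts on $\operatorname{Irr} G$ and on $\operatorname{Cl}(G)$. **Lemma.** Let $A$ be a subgroup of the group of table automorphisms of $G$. Let $\mathcal X$ be the partition of $\operatorname{Irr} G$ into $A$-orbits, and let $\mathcal K$ be the partition of $G$ whose members are the unions $\bigcup_{C\in\mathcal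 O}C$, where $\mathcal O$ runs over the $A$-orbits on $\operatorname{Cl}(G)$. Then $(\mathcal X,\mathcal K)$ is a supercharacter theory of $G$. -/

import Mathlib

/-- `Irr G`: the set of irreducible complex characters of `G`, i.e. of the functions `G → ℂ`
afforded (as trace functions) by irreducible complex representations of finite degree. -/
def Irr (G : Type*) [Group G] : Set (G → ℂ) :=
  {χ | ∃ (n : ℕ) (ρ : Representation ℂ G (Fin n → ℂ)), ρ.IsIrreducible ∧ ρ.character = χ}

/-- A finite group has only finitely many irreducible complex characters. -/
instance Irr.instFinite (G : Type*) [Group G] [Finite G] : Finite (Irr G) := by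
  classical
  have : Fintype G := Fintype.ofFinite G
  have hc : (Nat.card G : ℂ) ≠ 0 := Nat.cast_ne_zero.mpr Nat.card_pos.ne'
  have : Invertible (Nat.card G : ℂ) := invertibleOfNonzero hc
  let pair : Irr G → Module.Dual ℂ (G → ℂ) := fun ψ =>
    (Nat.card G : ℂ)⁻¹ • ∑ g : G, (ψ : G → ℂ) g⁻¹ • LinearMap.proj g
  have hpair : ∀ (χ ψ : Irr G), pair ψ (χ : G → ℂ) =
      (Nat.card G : ℂ)⁻¹ * ∑ g : G, (χ : G → ℂ) g * (ψ : G → ℂ) g⁻¹ := by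
    intro χ ψ
    simp [pair, mul_comm]
  have hli : LinearIndependent ℂ (fun χ : Irr G => (χ : G → ℂ)) := by
    refine LinearIndependent.of_pairwise_dual_eq_zero_one _ pair ?_ ?_
    · rintro ⟨ψ, n, ρ, hρ, rfl⟩ ⟨χ, m, θ, hθ, rfl⟩ hne
      rw [hpair]
      have := hρ
      have := hθ
      refine (Representation.char_orthonormal θ ρ).trans (if_neg ?_)
      rintro ⟨e⟩
      exact hne (Subtype.ext (Representation.char_iso e))
    · rintro ⟨χ, n, ρ, hρ, rfl⟩
      rw [hpair]
      have := hρ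
      exact (Representation.char_orthonormal ρ ρ).trans (if_pos ⟨Representation.Equiv.refl ρ⟩)
  exact hli.finite

/-- `σ_X = ∑_{χ ∈ X} χ(1) χ` for a set `X` of irreducible characters. -/
noncomputable def sigmaChar {G : Type*} [Group G] [Finite G] (X : Set (Irr G)) (g : G) : ℂ :=
  ∑ χ ∈ X.toFinite.toFinset, (χ : G → ℂ) 1 * (χ : G → ℂ) g

/-- `(𝒳, 𝒦)` is a supercharacter theory of the finite group `G`: `𝒳` is a partition of `Irr G`,
`𝒦` is a partition of `G`, both have the same number of members, and every `σ_X` with `X ∈ 𝒳` is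
constant on every member of `𝒦`. -/
structure IsSupercharacterTheory {G : Type*} [Group G] [Finite G]
    (𝒳 : Set (Set (Irr G))) (𝒦 : Set (Set G)) : Prop where
  isPartition_irr : Setoid.IsPartition 𝒳
  isPartition_group : Setoid.IsPartition 𝒦
  ncard_eq : 𝒳.ncard = 𝒦.ncard
  sigmaChar_eq : ∀ X ∈ 𝒳, ∀ K ∈ 𝒦, ∀ g ∈ K, ∀ h ∈ K, sigmaChar X g = sigmaChar X h

/-- The group of table automorphisms of the character table of `G`: the pairs `(σ, τ)` of a
permutation `σ` of `Irr G` and a permutation `τ` of the conjugacy classes of `G` such that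
`(σ χ)(h) = χ(g)` for all `χ`, all `g`, and every element `h` of the image under `τ` of the
class of `g`. -/
def tableAut (G : Type*) [Group G] :
    Subgroup (Equiv.Perm (Irr G) × Equiv.Perm (ConjClasses G)) where
  carrier := {p | ∀ (χ : Irr G) (g h : G), ConjClasses.mk h = p.2 (ConjClasses.mk g) →
    (p.1 χ : G → ℂ) h = (χ : G → ℂ) g}
  one_mem' := by
    rintro ⟨χ, n, ρ, hρ, rfl⟩ g h hgh
    obtain ⟨c, rfl⟩ := isConj_iff.mp (ConjClasses.mk_eq_mk_iff_isConj.mp hgh.symm)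
    exact ρ.char_conj g c
  mul_mem' := by
    intro p q hp hq χ g h hgh
    obtain ⟨k, hk⟩ := ConjClasses.exists_rep (q.2 (ConjClasses.mk g))
    have h1 : ConjClasses.mk h = p.2 (ConjClasses.mk k) := by
      rw [hk]; exact hgh
    exact (hp (q.1 χ) k h h1).trans (hq χ g k hk)
  inv_mem' := by
    intro p hp χ g h hgh
    have h1 : ConjClasses.mk g = p.2 (ConjClasses.mk h) := by
      rw [hgh]; exact (p.2.apply_symm_apply _).symm
    have h2 := hp (p.1.symm χ) h g h1
    rw [p.1.apply_symm_apply] at h2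
    exact h2.symm

/-- Table automorphisms act on `Irr G` through their first component. -/
instance tableAut.instMulActionIrr (G : Type*) [Group G] : MulAction (tableAut G) (Irr G) where
  smul p χ := p.1.1 χ
  one_smul _ := rfl
  mul_smul _ _ _ := rfl

/-- Table automorphisms act on the conjugacy classes through their second component. -/
instance tableAut.instMulActionConjClasses (G : Type*) [Group G] :
    MulAction (tableAut G) (ConjClasses G) where
  smul p c := p.1.2 c
  one_smul _ := rfl
  mul_smul _ _ _ := rfl

/-- The partition of `Irr G` into orbits under a group `A` of table automorphisms. -/
def irrOrbits {G : Type*} [Group G] (A : Subgroup (tableAut G)) : Set (Set (Irr G)) :=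
  Set.range fun χ : Irr G => MulAction.orbit A χ

/-- The partition of `G` given by the orbits of a group `A` of table automorphisms on the conjugacy
classes: the members are the unions of the classes in an orbit. -/
def classOrbits {G : Type*} [Group G] (A : Subgroup (tableAut G)) : Set (Set G) :=
  Set.range fun c : ConjClasses G => {g : G | ConjClasses.mk g ∈ MulAction.orbit A c}

open scoped MonoidAlgebra

/-! ### Linear independence and size of irreducible characters -/

namespace Irr

variable {G : Type*} [Group G]

/-! A table automorphism takes the value `χ(g)` to an equal value of another character in the orbit
`X` of `χ`. Reindexing the sum along it shows that `σ_X` is constant on class orbits, once degrees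
are known to be invariant. Invariance is not built in, as the class of `1` may move; it follows from
`|χ(g)| ≤ χ(1)`.

The two orbit counts agree by Brauer's permutation argument. The character table is an invariant
pairing between characters and classes. Its rows are independent by orthogonality; its columns are
independent because a class function pairing to zero with every character vanishes (Schur and
Maschke). Independence on one side embeds the functions on the orbits of that side into those on the
orbits of the other, so both inequalities hold. -/

theorem apply_eq_of_mk_eq (χ : Irr G) {g h : G} (hgh : ConjClasses.mk g = ConjClasses.mk h) :
    (χ : G → ℂ) g = (χ : G → ℂ) h := by
  obtain ⟨χ, n, ρ, hρ, rfl⟩ := χ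
  obtain ⟨c, rfl⟩ := isConj_iff.mp (ConjClasses.mk_eq_mk_iff_isConj.mp hgh)
  exact (ρ.char_conj g c).symm

theorem exists_apply_one_eq_natCast (χ : Irr G) : ∃ n : ℕ, (χ : G → ℂ) 1 = n := by
  obtain ⟨χ, n, ρ, hρ, rfl⟩ := χ
  exact ⟨_, ρ.char_one⟩

/-- The irreducible complex characters of a finite group are linearly independent. -/
theorem linearIndependent (G : Type*) [Group G] [Finite G] :
    LinearIndependent ℂ (fun χ : Irr G => (χ : G → ℂ)) := by
  classical
  have : Fintype G := Fintype.ofFinite G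
  have hc : (Nat.card G : ℂ) ≠ 0 := Nat.cast_ne_zero.mpr Nat.card_pos.ne'
  have : Invertible (Nat.card G : ℂ) := invertibleOfNonzero hc
  let pair : Irr G → Module.Dual ℂ (G → ℂ) := fun ψ =>
    (Nat.card G : ℂ)⁻¹ • ∑ g : G, (ψ : G → ℂ) g⁻¹ • LinearMap.proj g
  have hpair : ∀ (χ ψ : Irr G), pair ψ (χ : G → ℂ) =
      (Nat.card G : ℂ)⁻¹ * ∑ g : G, (χ : G → ℂ) g * (ψ : G → ℂ) g⁻¹ := by
    intro χ ψ
    simp [pair, mul_comm]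
  refine LinearIndependent.of_pairwise_dual_eq_zero_one _ pair ?_ ?_
  · rintro ⟨ψ, n, ρ, hρ, rfl⟩ ⟨χ, m, θ, hθ, rfl⟩ hne
    rw [hpair]
    have := hρ
    have := hθ
    refine (Representation.char_orthonormal θ ρ).trans (if_neg ?_)
    rintro ⟨e⟩
    exact hne (Subtype.ext (Representation.char_iso e))
  · rintro ⟨χ, n, ρ, hρ, rfl⟩
    rw [hpair]
    have := hρ
    exact (Representation.char_orthonormal ρ ρ).trans (if_pos ⟨Representation.Equiv.refl ρ⟩)

end Irr

/-- A finite-order endomorphism of a complex vector space has trace of norm at most the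
dimension. -/
theorem LinearMap.norm_trace_le_finrank_of_pow_eq_one {V : Type*} [AddCommGroup V] [Module ℂ V]
    [FiniteDimensional ℂ V] {f : Module.End ℂ V} {m : ℕ} (hm : m ≠ 0) (hf : f ^ m = 1) :
    ‖LinearMap.trace ℂ V f‖ ≤ Module.finrank ℂ V := by
  rw [Module.End.trace_eq_sum_roots_charpoly_of_splits (IsAlgClosed.splits _)]
  -- Every eigenvalue is an `m`-th root of unity, so the trace is a sum of at most `dim V` numbers
  -- of norm 1.
  have hroot : ∀ μ ∈ f.charpoly.roots, ‖μ‖ = 1 := by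
    intro μ hμ
    have hev : f.HasEigenvalue μ := by
      rw [Module.End.hasEigenvalue_iff_isRoot_charpoly]
      exact Polynomial.isRoot_of_mem_roots hμ
    obtain ⟨v, hv⟩ := hev.exists_hasEigenvector
    have h1 := hv.pow_apply m
    rw [hf, Module.End.one_apply] at h1
    have h2 : μ ^ m = 1 := by
      have : (μ ^ m - 1) • v = 0 := by rw [sub_smul, ← h1, one_smul, sub_self]
      exact sub_eq_zero.mp ((smul_eq_zero.mp this).resolve_right hv.2)
    exact Complex.norm_eq_one_of_pow_eq_one h2 hm
  calc ‖f.charpoly.roots.sum‖ ≤ (f.charpoly.roots.map fun μ => ‖μ‖).sum :=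
        norm_multiset_sum_le _
    _ = f.charpoly.roots.card := by
        rw [Multiset.map_congr rfl hroot]; simp
    _ ≤ Module.finrank ℂ V := by
        rw [← f.charpoly_natDegree]
        exact_mod_cast Polynomial.card_roots' _

theorem Irr.norm_apply_le {G : Type*} [Group G] [Finite G] (χ : Irr G) (g : G) :
    ‖(χ : G → ℂ) g‖ ≤ ‖(χ : G → ℂ) 1‖ := by
  obtain ⟨χ, n, ρ, hρ, rfl⟩ := χ
  change ‖ρ.character g‖ ≤ ‖ρ.character 1‖
  rw [ρ.char_one, Complex.norm_natCast]
  refine LinearMap.norm_trace_le_finrank_of_pow_eq_one (orderOf_pos g).ne' ?_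
  rw [← map_pow, pow_orderOf_eq_one, map_one]

/-! ### Completeness of the irreducible characters -/

section Completeness

variable {G : Type*} [Group G]

/-- The trace function of a simple `ℂ[G]`-module of finite dimension is an irreducible character. -/
theorem trace_lsmul_mem_Irr (S : Type*) [AddCommGroup S] [Module ℂ S] [Module ℂ[G] S]
    [IsScalarTower ℂ ℂ[G] S] [FiniteDimensional ℂ S] [IsSimpleModule ℂ[G] S] :
    (fun g : G => LinearMap.trace ℂ S (Algebra.lsmul ℂ ℂ S (MonoidAlgebra.of ℂ G g))) ∈ Irr G := by
  let e : S ≃ₗ[ℂ] (Fin (Module.finrank ℂ S) → ℂ) := (Module.finBasis ℂ S).equivFun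
  let φ : ℂ[G] →ₐ[ℂ] Module.End ℂ (Fin (Module.finrank ℂ S) → ℂ) :=
    (e.conjAlgEquiv ℂ).toAlgHom.comp (Algebra.lsmul ℂ ℂ S)
  let ρ : Representation ℂ G (Fin (Module.finrank ℂ S) → ℂ) :=
    φ.toRingHom.toMonoidHom.comp (MonoidAlgebra.of ℂ G)
  have hρ : ρ.asAlgebraHom = φ := by
    ext g : 2
    simp [ρ, φ]
  refine ⟨_, ρ, ?_, ?_⟩
  · rw [Representation.irreducible_iff_isSimpleModule_asModule]
    let f : ρ.asModule ≃ₗ[ℂ[G]] S :=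
      { (ρ.asModuleEquiv.trans e.symm) with
        map_smul' := fun r x => by
          have h := ρ.asModuleEquiv_map_smul r x
          simp only [AddHom.toFun_eq_coe, LinearMap.coe_toAddHom, LinearEquiv.coe_coe,
            LinearEquiv.trans_apply, RingHom.id_apply]
          rw [h, hρ]
          simp [φ, LinearEquiv.conjAlgEquiv_apply] }
    exact IsSimpleModule.congr f
  · funext g
    exact LinearMap.trace_conj' _ e

/-- A function on the conjugacy classes orthogonal to all irreducible characters kills every
simple module. -/
theorem smul_eq_zero_of_forall_sum_irr_eq_zero [Fintype G] {F : ConjClasses G → ℂ}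
    (hF : ∀ χ : Irr G, ∑ g : G, F (ConjClasses.mk g) * (χ : G → ℂ) g = 0)
    (S : Type*) [AddCommGroup S] [Module ℂ S] [Module ℂ[G] S]
    [IsScalarTower ℂ ℂ[G] S] [FiniteDimensional ℂ S] [IsSimpleModule ℂ[G] S] (s : S) :
    (∑ g : G, F (ConjClasses.mk g) • MonoidAlgebra.of ℂ G g) • s = 0 := by
  set z : ℂ[G] := ∑ g : G, F (ConjClasses.mk g) • MonoidAlgebra.of ℂ G g with hz
  -- The coefficients of `z` are constant on classes, so `z` is central and, by Schur, acts on `S`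
  -- as a scalar `c`.
  have hcomm : ∀ r : ℂ[G], r * z = z * r := by
    intro r
    induction r using MonoidAlgebra.induction_on with
    | of h =>
      rw [hz, Finset.mul_sum, Finset.sum_mul]
      refine Fintype.sum_equiv (MulAut.conj h).toEquiv _ _ fun g => ?_
      have h1 : ConjClasses.mk (h * g * h⁻¹) = ConjClasses.mk g :=
        ConjClasses.mk_eq_mk_iff_isConj.mpr (isConj_iff.mpr ⟨h⁻¹, by group⟩)
      simp only [MulEquiv.toEquiv_eq_coe, EquivLike.coe_coe, MulAut.conj_apply, h1]
      rw [mul_smul_comm, smul_mul_assoc, ← map_mul, ← map_mul, inv_mul_cancel_right]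
    | add a b ha hb => rw [add_mul, mul_add, ha, hb]
    | smul c a ha => rw [smul_mul_assoc, mul_smul_comm, ha]
  let Z : Module.End ℂ[G] S :=
    { toFun := fun s => z • s
      map_add' := smul_add z
      map_smul' := fun r s => by
        rw [RingHom.id_apply, smul_smul, smul_smul, hcomm] }
  obtain ⟨c, hc⟩ := (IsSimpleModule.algebraMap_end_bijective_of_isAlgClosed
    (A := ℂ[G]) (V := S) ℂ).2 Z
  have hcs : ∀ s : S, z • s = c • s := fun s => congr($hc.symm s)
  -- The trace of `z` on `S` is the pairing of `F` with the character of `S`; it also equals `c *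
  -- dim S`, which forces `c = 0`.
  have htr : LinearMap.trace ℂ S (Algebra.lsmul ℂ ℂ S z) = 0 := by
    rw [hz, map_sum, map_sum, ← hF ⟨_, trace_lsmul_mem_Irr S⟩]
    exact Finset.sum_congr rfl fun g _ => by rw [map_smul, map_smul, smul_eq_mul]
  have hZ : Algebra.lsmul ℂ ℂ S z = c • (1 : Module.End ℂ S) := LinearMap.ext hcs
  have : Nontrivial S := IsSimpleModule.nontrivial ℂ[G] S
  rw [hZ, map_smul, LinearMap.trace_one, smul_eq_mul, mul_eq_zero] at htr
  have hc0 : c = 0 := htr.resolve_right (Nat.cast_ne_zero.mpr Module.finrank_pos.ne')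
  rw [hcs, hc0, zero_smul]

/-- A class function orthogonal to all irreducible characters vanishes. -/
theorem eq_zero_of_forall_sum_irr_eq_zero [Fintype G] {F : ConjClasses G → ℂ}
    (hF : ∀ χ : Irr G, ∑ g : G, F (ConjClasses.mk g) * (χ : G → ℂ) g = 0) : F = 0 := by
  set z : ℂ[G] := ∑ g : G, F (ConjClasses.mk g) • MonoidAlgebra.of ℂ G g with hz
  have : NeZero (Nat.card G : ℂ) := ⟨Nat.cast_ne_zero.mpr Nat.card_pos.ne'⟩
  -- By Maschke the simple left ideals generate `ℂ[G]`, and `z` kills each of them. Quantifying over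
  -- `r` makes the condition stable under left multiplication, so it passes to the span.
  have hle : (⊤ : Submodule ℂ[G] ℂ[G]) ≤
      Submodule.span ℂ[G] {x | ∀ r : ℂ[G], z * (r * x) = 0} := by
    rw [← IsSemisimpleModule.sSup_simples_eq_top ℂ[G] ℂ[G]]
    refine sSup_le fun S hS x hx => Submodule.subset_span fun r => ?_
    have : IsSimpleModule ℂ[G] S := hS
    have : FiniteDimensional ℂ S :=
      inferInstanceAs (FiniteDimensional ℂ (S.restrictScalars ℂ))
    have := smul_eq_zero_of_forall_sum_irr_eq_zero hF S ⟨r * x, S.smul_mem r hx⟩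
    exact congr_arg Subtype.val this
  have hz0 : z = 0 := by
    have h1 : (1 : ℂ[G]) ∈ Submodule.span ℂ[G] {x | ∀ r : ℂ[G], z * (r * x) = 0} :=
      hle Submodule.mem_top
    have h2 : ∀ x ∈ Submodule.span ℂ[G] {x | ∀ r : ℂ[G], z * (r * x) = 0},
        ∀ r : ℂ[G], z * (r * x) = 0 := by
      intro x hx
      induction hx using Submodule.span_induction with
      | mem x hx => exact hx
      | zero => simp
      | add x y _ _ hx hy => intro r; rw [mul_add, mul_add, hx, hy, add_zero]
      | smul a x _ hx => intro r; rw [smul_eq_mul, ← mul_assoc r]; exact hx _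
    simpa using h2 1 h1 1
  funext c
  obtain ⟨g, rfl⟩ := ConjClasses.exists_rep c
  exact linearIndependent_iff'.mp (MonoidAlgebra.basis G ℂ).linearIndependent Finset.univ
    (fun g => F (ConjClasses.mk g)) hz0 g (Finset.mem_univ g)

end Completeness

/-! ### Orbit partitions -/

theorem MulAction.isPartition_range_orbit (M α : Type*) [Group M] [MulAction M α] :
    Setoid.IsPartition (Set.range fun a : α => MulAction.orbit M a) := by
  refine ⟨?_, fun a => ⟨MulAction.orbit M a, ⟨⟨a, rfl⟩, MulAction.mem_orbit_self a⟩, ?_⟩⟩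
  · rintro ⟨a, ha⟩
    exact (MulAction.nonempty_orbit a).ne_empty ha
  · rintro _ ⟨⟨b, rfl⟩, hab⟩
    exact (MulAction.orbit_eq_iff.mpr hab).symm

theorem Setoid.IsPartition.preimage {α β : Type*} {P : Set (Set α)} (hP : Setoid.IsPartition P)
    {f : β → α} (hf : Function.Surjective f) :
    Setoid.IsPartition ((fun s => f ⁻¹' s) '' P) := by
  refine ⟨?_, fun b => ?_⟩
  · rintro ⟨s, hs, hempty⟩
    rw [hf.preimage_injective (hempty.trans Set.preimage_empty.symm)] at hs
    exact hP.1 hs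
  · obtain ⟨s, ⟨hs, hbs⟩, huniq⟩ := hP.2 (f b)
    refine ⟨f ⁻¹' s, ⟨⟨s, hs, rfl⟩, hbs⟩, ?_⟩
    rintro _ ⟨⟨t, ht, rfl⟩, hbt⟩
    exact congr_arg _ (huniq t ⟨ht, hbt⟩)

theorem MulAction.ncard_range_orbit (M α : Type*) [Group M] [MulAction M α] :
    (Set.range fun a : α => MulAction.orbit M a).ncard =
      Nat.card (MulAction.orbitRel.Quotient M α) := by
  have hker : Setoid.ker (fun a : α => MulAction.orbit M a) = MulAction.orbitRel M α :=
    Setoid.ext fun a b => MulAction.orbit_eq_iff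
  rw [← Nat.card_coe_set_eq, ← Nat.card_congr (Setoid.quotientKerEquivRange _), hker]

/-! ### The character table as an invariant pairing -/

namespace Irr

variable {G : Type*} [Group G]

/-- The value of an irreducible character on a conjugacy class. -/
noncomputable def classValue (χ : Irr G) (c : ConjClasses G) : ℂ :=
  (χ : G → ℂ) (Quotient.out c)

theorem classValue_mk (χ : Irr G) (g : G) : classValue χ (ConjClasses.mk g) = (χ : G → ℂ) g :=
  apply_eq_of_mk_eq χ (Quotient.out_eq (ConjClasses.mk g))

theorem classValue_smul_smul (A : Subgroup (tableAut G)) (a : A) (χ : Irr G)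
    (c : ConjClasses G) : classValue (a • χ) (a • c) = classValue χ c := by
  obtain ⟨g, rfl⟩ := ConjClasses.exists_rep c
  obtain ⟨h, hh⟩ := ConjClasses.exists_rep (a • ConjClasses.mk g)
  rw [← hh, classValue_mk, classValue_mk]
  exact a.1.2 χ g h hh

theorem smul_apply_of_mk_eq_smul (A : Subgroup (tableAut G)) (a : A) (χ : Irr G) {g h : G}
    (hgh : ConjClasses.mk h = a • ConjClasses.mk g) :
    ((a • χ : Irr G) : G → ℂ) h = (χ : G → ℂ) g :=
  a.1.2 χ g h hgh

variable [Finite G]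

/-- Table automorphisms preserve the degrees of the irreducible characters. -/
theorem smul_apply_one (A : Subgroup (tableAut G)) (a : A) (χ : Irr G) :
    ((a • χ : Irr G) : G → ℂ) 1 = (χ : G → ℂ) 1 := by
  have : Fintype (Irr G) := Fintype.ofFinite _
  obtain ⟨z, hz⟩ := ConjClasses.exists_rep (a • ConjClasses.mk (1 : G))
  -- The degree of `ψ` is the value of `a • ψ` at `z`, so `a` never lowers a degree. As `a` permutes
  -- the finite set of characters, the degree sums agree and each inequality is an equality.
  have hle : ∀ ψ : Irr G, ‖(ψ : G → ℂ) 1‖ ≤ ‖((a • ψ : Irr G) : G → ℂ) 1‖ := fun ψ => by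
    rw [← smul_apply_of_mk_eq_smul A a ψ hz]
    exact norm_apply_le _ _
  have hsum : ∑ ψ : Irr G, ‖(ψ : G → ℂ) 1‖ = ∑ ψ : Irr G, ‖((a • ψ : Irr G) : G → ℂ) 1‖ :=
    (Equiv.sum_comp (MulAction.toPerm a) fun ψ : Irr G => ‖(ψ : G → ℂ) 1‖).symm
  have h := (Finset.sum_eq_sum_iff_of_le fun ψ _ => hle ψ).mp hsum χ (Finset.mem_univ χ)
  obtain ⟨m, hm⟩ := exists_apply_one_eq_natCast χ
  obtain ⟨n, hn⟩ := exists_apply_one_eq_natCast (a • χ)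
  rw [hm, hn, Complex.norm_natCast, Complex.norm_natCast] at h
  rw [hm, hn, Nat.cast_inj.mp h]

/-- Column independence. Dividing `F` by the class sizes turns the sum over classes into a sum over
`G`, where completeness applies. -/
theorem eq_zero_of_forall_sum_classValue_eq_zero [Fintype (ConjClasses G)]
    {F : ConjClasses G → ℂ} (hF : ∀ χ : Irr G, ∑ c, F c * classValue χ c = 0) : F = 0 := by
  classical
  have : Fintype G := Fintype.ofFinite G
  let N : ConjClasses G → ℂ := fun c => (Finset.univ.filter fun g : G => ConjClasses.mk g = c).card
  have hN : ∀ c, N c ≠ 0 := fun c => by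
    obtain ⟨g, hg⟩ := ConjClasses.exists_rep c
    exact Nat.cast_ne_zero.mpr (Finset.card_ne_zero.mpr ⟨g, by simpa using hg⟩)
  have h0 : (fun c => F c / N c) = 0 := by
    refine eq_zero_of_forall_sum_irr_eq_zero fun χ => ?_
    rw [← hF χ, ← Finset.sum_fiberwise (g := ConjClasses.mk)]
    refine Finset.sum_congr rfl fun c _ => ?_
    rw [Finset.sum_congr rfl (g := fun _ => F c / N c * classValue χ c), Finset.sum_const,
      nsmul_eq_mul]
    · change N c * _ = _
      field_simp [hN c]
    · intro g hg
      obtain rfl := (Finset.mem_filter.mp hg).2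
      rw [classValue_mk]
  funext c
  exact (div_eq_zero_iff.mp (congr_fun h0 c)).resolve_right (hN c)

theorem eq_zero_of_forall_sum_mul_classValue_eq_zero [Fintype (Irr G)] {a : Irr G → ℂ}
    (ha : ∀ c, ∑ χ : Irr G, a χ * classValue χ c = 0) : a = 0 := by
  funext χ
  refine linearIndependent_iff'.mp (linearIndependent G) Finset.univ a ?_ χ (Finset.mem_univ χ)
  funext g
  rw [Finset.sum_apply]
  refine Eq.trans (Finset.sum_congr rfl fun ψ _ => ?_) (ha (ConjClasses.mk g))
  rw [classValue_mk]
  rfl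

end Irr

/-- Brauer's permutation lemma for pairings: a group acting compatibly on the rows and the columns
of a table whose rows are linearly independent has at most as many orbits on the rows as on the
columns. -/
theorem MulAction.card_orbits_le_of_pairing {M α β : Type*} [Group M] [MulAction M α]
    [MulAction M β] [Fintype α] [Finite β] (t : α → β → ℂ)
    (ht : ∀ (m : M) a b, t (m • a) (m • b) = t a b)
    (hli : ∀ F : α → ℂ, (∀ b, ∑ a, F a * t a b = 0) → F = 0) :
    Nat.card (MulAction.orbitRel.Quotient M α) ≤ Nat.card (MulAction.orbitRel.Quotient M β) := by
  have : Fintype (MulAction.orbitRel.Quotient M α) := Fintype.ofFinite _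
  have : Fintype (MulAction.orbitRel.Quotient M β) := Fintype.ofFinite _
  let π : α → MulAction.orbitRel.Quotient M α := Quotient.mk _
  let T : (MulAction.orbitRel.Quotient M α → ℂ) →ₗ[ℂ] (MulAction.orbitRel.Quotient M β → ℂ) :=
    { toFun := fun F q => ∑ a, F (π a) * t a q.out
      map_add' := fun F F' => by
        funext q; simp only [Pi.add_apply, add_mul, Finset.sum_add_distrib]
      map_smul' := fun c F => by
        funext q; simp only [Pi.smul_apply, smul_eq_mul, mul_assoc, Finset.mul_sum,
          RingHom.id_apply] }
  have hT : Function.Injective T := by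
    rw [injective_iff_map_eq_zero]
    intro F hF
    -- Since `F ∘ π` and `t` are invariant, the combination of rows depends only on the orbit of
    -- `b`; vanishing at the chosen representatives is vanishing everywhere.
    have hzero : (fun a => F (π a)) = 0 := by
      refine hli _ fun b => ?_
      obtain ⟨m, hm⟩ : ∃ m : M, m • b = (Quotient.mk (MulAction.orbitRel M β) b).out :=
        MulAction.orbitRel_apply.mp
          (Quotient.exact (Quotient.out_eq (Quotient.mk (MulAction.orbitRel M β) b)))
      refine Eq.trans ?_ (congr_fun hF (Quotient.mk (MulAction.orbitRel M β) b))
      refine Fintype.sum_equiv (MulAction.toPerm m) _ _ fun a => ?_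
      have hπ : π (m • a) = π a :=
        Quotient.sound (MulAction.orbitRel_apply.mpr (MulAction.mem_orbit a m))
      rw [MulAction.toPerm_apply, hπ, ← hm, ht]
    funext q
    obtain ⟨a, rfl⟩ := Quotient.exists_rep q
    exact congr_fun hzero a
  have h := LinearMap.finrank_le_finrank_of_injective hT
  simpa only [Module.finrank_fintype_fun_eq_card, Fintype.card_eq_nat_card] using h

theorem sigmaChar_orbit_eq {G : Type*} [Group G] [Finite G] (A : Subgroup (tableAut G)) (a : A)
    (χ₀ : Irr G) {g h : G} (hgh : ConjClasses.mk h = a • ConjClasses.mk g) :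
    sigmaChar (MulAction.orbit A χ₀) g = sigmaChar (MulAction.orbit A χ₀) h := by
  unfold sigmaChar
  refine Finset.sum_equiv (MulAction.toPerm a) (fun χ => ?_) fun χ _ => ?_
  · rw [Set.Finite.mem_toFinset, Set.Finite.mem_toFinset, MulAction.toPerm_apply,
      ← MulAction.orbit_eq_iff, ← MulAction.orbit_eq_iff, MulAction.orbit_smul]
  · rw [MulAction.toPerm_apply, Irr.smul_apply_one, Irr.smul_apply_of_mk_eq_smul A a χ hgh]

/-- Preimage along a surjection is injective on sets, so this form transfers both the partition
property and the number of members from the classes to `G`. -/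
theorem classOrbits_eq_image {G : Type*} [Group G] (A : Subgroup (tableAut G)) :
    classOrbits A = (fun s => ConjClasses.mk ⁻¹' s) ''
      Set.range fun c : ConjClasses G => MulAction.orbit A c := by
  rw [← Set.range_comp]
  rfl

theorem card_orbits_irr_eq_card_orbits_conjClasses {G : Type*} [Group G] [Finite G]
    (A : Subgroup (tableAut G)) :
    Nat.card (MulAction.orbitRel.Quotient A (Irr G)) =
      Nat.card (MulAction.orbitRel.Quotient A (ConjClasses G)) := by
  have : Fintype (Irr G) := Fintype.ofFinite _
  have : Fintype (ConjClasses G) := Fintype.ofFinite _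
  refine le_antisymm ?_ ?_
  · exact MulAction.card_orbits_le_of_pairing Irr.classValue (Irr.classValue_smul_smul A)
      fun _ => Irr.eq_zero_of_forall_sum_mul_classValue_eq_zero
  · exact MulAction.card_orbits_le_of_pairing (fun c χ => Irr.classValue χ c)
      (fun a c χ => Irr.classValue_smul_smul A a χ c)
      fun _ => Irr.eq_zero_of_forall_sum_classValue_eq_zero

theorem mainTheorem11 {G : Type*} [Group G] [Finite G] (A : Subgroup (tableAut G)) :
    IsSupercharacterTheory (irrOrbits A) (classOrbits A) := by
  have hmk : Function.Surjective (ConjClasses.mk : G → ConjClasses G) := ConjClasses.exists_rep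
  refine ⟨MulAction.isPartition_range_orbit A (Irr G), ?_, ?_, ?_⟩
  · rw [classOrbits_eq_image]
    exact (MulAction.isPartition_range_orbit A (ConjClasses G)).preimage hmk
  · rw [classOrbits_eq_image, Set.ncard_image_of_injective _ hmk.preimage_injective,
      MulAction.ncard_range_orbit, ← card_orbits_irr_eq_card_orbits_conjClasses]
    exact MulAction.ncard_range_orbit A (Irr G)
  · rintro _ ⟨χ₀, rfl⟩ _ ⟨c, rfl⟩ g hg h hh
    obtain ⟨a, ha⟩ : ∃ a : A, a • ConjClasses.mk g = ConjClasses.mk h :=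
      MulAction.orbit_eq_iff.mp ((MulAction.orbit_eq_iff.mpr hh).trans
        (MulAction.orbit_eq_iff.mpr hg).symm)
    exact sigmaChar_orbit_eq A a χ₀ ha.symm
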